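/- Let $\kappa\in\mathbb R$ and let $(X,d)$ be a $\mathrm{CAT}(\kappa)$ space; if $\kappa>0$, assume in addition that $\operatorname{diam}(X)<\pi/(2\sqrt\kappa)$. (Here $X$ is a $\mathrm{CAT}(\kappa)$ space if any two points, at distance less than $\pi/\sqrt\kappa$ when $\kappa>0$, are joined by a geodesic, and every geodesic triangle, of perimeter less than $2\pi/\sqrt\kappa$ when $\kappa>0$, satisfies $d(p,q)\le d(\bar p,\bar q)$ for all points $p,q$ on its sides and the corresponding points $\bar p,\bar q$ of a comparison triangle with the same side lengths in the simply connected complete surface of constant curvature $\kappa$.) Let $r\ge 1$ and let $C_1,\dots,C_r\subseteq X$ be closed sets with $\bigcap_{i=1}^r C_i\neq\emptyset$, each of which is convex, that is, contains every geodesic segment joining two of its points. For a nonempty $C\subseteq X$, the metric projection of $x \in X$ is the set $P_C(x)=\{c\in C: d(x,c)=\inf_{c'\in C}d(x,c')\}$. (a) If $X$ is complete, then $P_{C_i}(x)$ consists of exactly one point for every $x\in X$ and $i=1,\dots,r$. (b) Suppose (without assuming that $X$ is complete) that the projections are defined on all of $X$, i.e. let $P_1,\dots,P_r:X\to X$ be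 mappings with $P_i(x)\in P_{C_i}(x)$ for all $x\in X$ and all $i$. Let $(x_n)_{n\ge0}$ be any sequence in $X$ with $$d\big(x_{n+1},P_{[n]}(x_n)\big)\le\varepsilon_n\quad\text{for all } n\ge 0,\qquad [n]:=(n \bmod r)+1,$$ where $\varepsilon_n \ge 0$ and $\sum_{n=0}^\infty\varepsilon_n<\infty$. Then $(x_n)$ is asymptotically regular: $\lim_{n\to\infty}d(x_n,x_{n+1})=0$. Moreover the mapping $T=P_1\circ\cdots\circ P_r$ is asymptotically regular: $\lim_{n\to\infty}d(T^nx,T^{n+1}x)=0$ for every $x\in X$. -/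

import Mathlib

open Filter Topology

/-- A geodesic path from `x` to `y`, parametrized by `[0, dist x y]` (the values of `γ` outside
this interval are irrelevant). -/
def IsGeodesicPath {X : Type*} [MetricSpace X] (γ : ℝ → X) (x y : X) : Prop :=
  γ 0 = x ∧ γ (dist x y) = y ∧
    ∀ s ∈ Set.Icc 0 (dist x y), ∀ t ∈ Set.Icc 0 (dist x y), dist (γ s) (γ t) = |s - t|

/-- A set is convex if it contains every geodesic segment joining two of its points. -/
def GeodesicConvex {X : Type*} [MetricSpace X] (C : Set X) : Prop :=
  ∀ x ∈ C, ∀ y ∈ C, ∀ γ : ℝ → X, IsGeodesicPath γ x y → ∀ t ∈ Set.Icc 0 (dist x y), γ t ∈ C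

/-- The distance of the sphere of constant curvature `κ > 0`, on the points of the unit sphere of
Euclidean three-space: the angle between two unit vectors, divided by `√κ`. -/
noncomputable def sphericalDist (κ : ℝ) (u v : Metric.sphere (0 : EuclideanSpace ℝ (Fin 3)) 1) :
    ℝ :=
  InnerProductGeometry.angle (u : EuclideanSpace ℝ (Fin 3)) (v : EuclideanSpace ℝ (Fin 3)) / √κ

/-- The Lorentz form on three-space. -/
def lorentzForm (u v : Fin 3 → ℝ) : ℝ := u 0 * v 0 + u 1 * v 1 - u 2 * v 2

/-- The hyperboloid model of the hyperbolic plane: the upper sheet of `⟨u, u⟩ = -1`. -/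
def Hyperboloid : Type := {u : Fin 3 → ℝ // lorentzForm u u = -1 ∧ 0 < u 2}

/-- The distance of the hyperbolic plane of constant curvature `κ < 0`. -/
noncomputable def hyperbolicDist (κ : ℝ) (u v : Hyperboloid) : ℝ :=
  Real.arcosh (-lorentzForm u.1 v.1) / √(-κ)

/-- The points `x y z` of `X` have a comparison triangle `x' y' z'` in the model plane `M`, with
distance function `dM`, such that `dist p q ≤ dM p' q'` whenever `p` lies on a geodesic segment
`[x, y]`, `q` lies on a geodesic segment `[x, z]`, and `p'`, `q'` are their comparison points on
`[x', y']` and `[x', z']`. As the vertices may be relabelled, this covers every pair of sides. -/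
def TriangleComparison {X : Type*} [MetricSpace X] {M : Type*} (dM : M → M → ℝ) (x y z : X) :
    Prop :=
  ∃ x' y' z' : M, dM x' y' = dist x y ∧ dM y' z' = dist y z ∧ dM x' z' = dist x z ∧
    ∀ γ σ : ℝ → X, IsGeodesicPath γ x y → IsGeodesicPath σ x z →
      ∀ s ∈ Set.Icc 0 (dist x y), ∀ t ∈ Set.Icc 0 (dist x z), ∀ p' q' : M,
        dM x' p' = dist x (γ s) → dM p' y' = dist (γ s) y →
        dM x' q' = dist x (σ t) → dM q' z' = dist (σ t) z →
          dist (γ s) (σ t) ≤ dM p' q'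

/-- `CAT(κ)` spaces: any two points (at distance less than `π / √κ` if `κ > 0`) are joined by a
geodesic, and geodesic triangles (of perimeter less than `2π / √κ` if `κ > 0`) are no thicker than
their comparison triangles in the simply connected plane of constant curvature `κ`. -/
structure IsCAT (κ : ℝ) (X : Type*) [MetricSpace X] : Prop where
  geodesic : ∀ x y : X, (0 < κ → dist x y < Real.pi / √κ) → ∃ γ : ℝ → X, IsGeodesicPath γ x y
  hyperbolic : κ < 0 → ∀ x y z : X, TriangleComparison (hyperbolicDist κ) x y z
  euclidean : κ = 0 → ∀ x y z : X,
    TriangleComparison (fun u v : EuclideanSpace ℝ (Fin 2) => dist u v) x y z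
  spherical : 0 < κ → ∀ x y z : X, dist x y + dist y z + dist x z < 2 * (Real.pi / √κ) →
    TriangleComparison (sphericalDist κ) x y z

/-- The (set-valued) metric projection onto a nonempty set `C`. -/
def metricProjection {X : Type*} [MetricSpace X] (C : Set X) (x : X) : Set X :=
  {c | c ∈ C ∧ dist x c = Metric.infDist x C}

/-- Asymptotic regularity of a sequence. -/
def AsymptoticallyRegularSeq {X : Type*} [MetricSpace X] (x : ℕ → X) : Prop :=
  Tendsto (fun n => dist (x n) (x (n + 1))) atTop (𝓝 0)

/-- Asymptotic regularity of a mapping: every Picard iteration is asymptotically regular. -/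
def AsymptoticallyRegularMap {X : Type*} [MetricSpace X] (T : X → X) : Prop :=
  ∀ x : X, AsymptoticallyRegularSeq (fun n => T^[n] x)

/-- The composition `T 0 ∘ T 1 ∘ ⋯ ∘ T (r - 1)`. -/
def finComp {X : Type*} {r : ℕ} (T : Fin r → X → X) : X → X :=
  (List.ofFn T).foldr (fun f g => f ∘ g) id

/-! All curvatures are treated at once through a gauge `h` with `d(w, Pw)² ≤ A * (h (d(w, z)) - h
(d(Pw, z)))` for `P` a projection onto a convex set containing `z`. In the model planes Stewart's
relation (the distance from a vertex to a point of the opposite side) is an equality; comparison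
makes it an inequality in `X`. At the midpoint it gives uniform convexity, hence (a); at a closest
point, as the parameter tends to `0`, it gives the Pythagorean inequality above. The gauges are
`t²`, `cosh (√(-κ) t)` and `-cos (√κ t)`; for `κ > 0` the diameter bound keeps the cosines away from
`0`.

For (b), fix `z` in all `C i`. Projections do not increase the distance to `z`, so up to the
summable errors these distances decrease and converge. The gauge inequality forces the displacement
by each projection to `0`. The limiting form of this property is stable under composition, which
settles `T`. -/

namespace IsGeodesicPath

variable {X : Type*} [MetricSpace X] {γ : ℝ → X} {x y : X}

theorem dist_left (h : IsGeodesicPath γ x y) {s : ℝ} (hs : s ∈ Set.Icc 0 (dist x y)) :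
    dist x (γ s) = s := by
  have := h.2.2 0 ⟨le_rfl, dist_nonneg⟩ s hs
  rw [h.1] at this
  rw [this, zero_sub, abs_neg, abs_of_nonneg hs.1]

theorem dist_right (h : IsGeodesicPath γ x y) {s : ℝ} (hs : s ∈ Set.Icc 0 (dist x y)) :
    dist (γ s) y = dist x y - s := by
  have := h.2.2 s hs (dist x y) ⟨dist_nonneg, le_rfl⟩
  rw [h.2.1] at this
  rw [this, abs_sub_comm, abs_of_nonneg (sub_nonneg.2 hs.2)]

end IsGeodesicPath

/-- Comparison of a point on one side of a triangle with the opposite vertex. -/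
theorem TriangleComparison.vertex {X : Type*} [MetricSpace X] {M : Type*} {dM : M → M → ℝ}
    {x y z : X} (h : TriangleComparison dM x y z) (hM : ∀ u, dM u u = 0)
    {γ σ : ℝ → X} (hγ : IsGeodesicPath γ x y) (hσ : IsGeodesicPath σ x z) :
    ∃ x' y' z' : M, dM x' y' = dist x y ∧ dM y' z' = dist y z ∧ dM x' z' = dist x z ∧
      ∀ s ∈ Set.Icc 0 (dist x y), ∀ p' : M, dM x' p' = s → dM p' y' = dist x y - s →
        dist (γ s) z ≤ dM p' z' := by
  -- The opposite vertex is the endpoint of `σ`, and `z'` serves as its own comparison point because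
  -- `dM z' z' = 0`.
  obtain ⟨x', y', z', hxy, hyz, hxz, H⟩ := h
  refine ⟨x', y', z', hxy, hyz, hxz, fun s hs p' h1 h2 => ?_⟩
  have := H γ σ hγ hσ s hs (dist x z) ⟨dist_nonneg, le_rfl⟩ p' z'
    (by rw [h1, hγ.dist_left hs]) (by rw [h2, hγ.dist_right hs])
    (by rw [hxz, hσ.2.1]) (by rw [hM, hσ.2.1, dist_self])
  rwa [hσ.2.1] at this

/-! ### The model planes -/

theorem norm_sphere (u : Metric.sphere (0 : EuclideanSpace ℝ (Fin 3)) 1) :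
    ‖(u : EuclideanSpace ℝ (Fin 3))‖ = 1 := by simp

theorem mul_sphericalDist {κ : ℝ} (hκ : 0 < κ)
    (u v : Metric.sphere (0 : EuclideanSpace ℝ (Fin 3)) 1) :
    √κ * sphericalDist κ u v =
      InnerProductGeometry.angle (u : EuclideanSpace ℝ (Fin 3)) (v : EuclideanSpace ℝ (Fin 3)) :=
  mul_div_cancel₀ _ (Real.sqrt_pos.2 hκ).ne'

theorem cos_sphericalDist {κ : ℝ} (hκ : 0 < κ)
    (u v : Metric.sphere (0 : EuclideanSpace ℝ (Fin 3)) 1) :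
    Real.cos (√κ * sphericalDist κ u v) =
      inner ℝ (u : EuclideanSpace ℝ (Fin 3)) (v : EuclideanSpace ℝ (Fin 3)) := by
  rw [mul_sphericalDist hκ, InnerProductGeometry.cos_angle]
  simp

theorem sphericalDist_eq {κ : ℝ} (hκ : 0 < κ)
    {u v : Metric.sphere (0 : EuclideanSpace ℝ (Fin 3)) 1} {t : ℝ} (h0 : 0 ≤ √κ * t)
    (hπ : √κ * t ≤ Real.pi)
    (h : inner ℝ (u : EuclideanSpace ℝ (Fin 3)) (v : EuclideanSpace ℝ (Fin 3)) =
      Real.cos (√κ * t)) : sphericalDist κ u v = t := by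
  have hk := Real.sqrt_pos.2 hκ
  rw [sphericalDist, InnerProductGeometry.angle, h]
  simp only [norm_sphere, mul_one, div_one]
  rw [Real.arccos_cos h0 hπ, mul_div_cancel_left₀ _ hk.ne']

/-- Spherical interpolation between two points. -/
theorem exists_sphere_interpolation (x y : Metric.sphere (0 : EuclideanSpace ℝ (Fin 3)) 1)
    {a b : ℝ} (hab : 0 < Real.sin (a + b))
    (hxy : inner ℝ (x : EuclideanSpace ℝ (Fin 3)) (y : EuclideanSpace ℝ (Fin 3)) =
      Real.cos (a + b)) :
    ∃ p : Metric.sphere (0 : EuclideanSpace ℝ (Fin 3)) 1,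
      inner ℝ (x : EuclideanSpace ℝ (Fin 3)) (p : EuclideanSpace ℝ (Fin 3)) = Real.cos b ∧
      inner ℝ (p : EuclideanSpace ℝ (Fin 3)) (y : EuclideanSpace ℝ (Fin 3)) = Real.cos a ∧
      ∀ z : EuclideanSpace ℝ (Fin 3),
        Real.sin (a + b) * inner ℝ (p : EuclideanSpace ℝ (Fin 3)) z =
          Real.sin a * inner ℝ (x : EuclideanSpace ℝ (Fin 3)) z +
            Real.sin b * inner ℝ (y : EuclideanSpace ℝ (Fin 3)) z := by
  have hx : inner ℝ (x : EuclideanSpace ℝ (Fin 3)) (x : EuclideanSpace ℝ (Fin 3)) = (1 : ℝ) := by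
    rw [real_inner_self_eq_norm_sq, norm_sphere, one_pow]
  have hy : inner ℝ (y : EuclideanSpace ℝ (Fin 3)) (y : EuclideanSpace ℝ (Fin 3)) = (1 : ℝ) := by
    rw [real_inner_self_eq_norm_sq, norm_sphere, one_pow]
  have ha := Real.sin_sq_add_cos_sq a
  have hb := Real.sin_sq_add_cos_sq b
  -- The point of the great arc at angle `b` from `x` and `a` from `y`. Its pairing with any `z` is
  -- linear in `x` and `y`; `z = q` yields norm one.
  set q : EuclideanSpace ℝ (Fin 3) := (Real.sin (a + b))⁻¹ •
    (Real.sin a • (x : EuclideanSpace ℝ (Fin 3)) + Real.sin b • (y : EuclideanSpace ℝ (Fin 3)))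
    with hq
  have hqz : ∀ z : EuclideanSpace ℝ (Fin 3), Real.sin (a + b) * inner ℝ q z =
      Real.sin a * inner ℝ (x : EuclideanSpace ℝ (Fin 3)) z +
        Real.sin b * inner ℝ (y : EuclideanSpace ℝ (Fin 3)) z := by
    intro z
    rw [hq, real_inner_smul_left, mul_inv_cancel_left₀ hab.ne', inner_add_left,
      real_inner_smul_left, real_inner_smul_left]
  have hqx : inner ℝ (x : EuclideanSpace ℝ (Fin 3)) q = Real.cos b := by
    apply mul_left_cancel₀ hab.ne'
    rw [real_inner_comm, hqz, hx, real_inner_comm, hxy, Real.sin_add, Real.cos_add]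
    linear_combination (-Real.sin a) * hb
  have hqy : inner ℝ q (y : EuclideanSpace ℝ (Fin 3)) = Real.cos a := by
    apply mul_left_cancel₀ hab.ne'
    rw [hqz, hy, hxy, Real.sin_add, Real.cos_add]
    linear_combination (-Real.sin b) * ha
  have hqq : inner ℝ q q = (1 : ℝ) := by
    apply mul_left_cancel₀ hab.ne'
    rw [hqz, hqx, real_inner_comm, hqy, Real.sin_add]
    ring
  have hn : ‖q‖ = 1 := by
    rw [real_inner_self_eq_norm_sq] at hqq
    exact (pow_eq_one_iff_of_nonneg (norm_nonneg _) two_ne_zero).1 hqq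
  exact ⟨⟨q, by simpa using hn⟩, hqx, hqy, hqz⟩

theorem lorentzForm_comm (u v : Fin 3 → ℝ) : lorentzForm u v = lorentzForm v u := by
  simp only [lorentzForm]; ring

/-- The reversed Cauchy-Schwarz inequality on the hyperboloid. -/
theorem one_le_neg_lorentzForm (u v : Hyperboloid) : 1 ≤ -lorentzForm u.1 v.1 := by
  obtain ⟨u, hu, hu2⟩ := u
  obtain ⟨v, hv, hv2⟩ := v
  rw [lorentzForm] at hu hv
  change 1 ≤ -(u 0 * v 0 + u 1 * v 1 - u 2 * v 2)
  have h1 : (u 0 * v 0 + u 1 * v 1 + 1) ^ 2 ≤ (u 2 * v 2) ^ 2 := by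
    have e : (u 2 * v 2) ^ 2 = (1 + u 0 ^ 2 + u 1 ^ 2) * (1 + v 0 ^ 2 + v 1 ^ 2) := by
      rw [mul_pow]; congr 1 <;> linarith
    rw [e]
    -- By Lagrange's identity the difference of the two sides is exactly the sum of these squares.
    nlinarith [sq_nonneg (u 0 * v 1 - u 1 * v 0), sq_nonneg (u 0 - v 0), sq_nonneg (u 1 - v 1)]
  have := abs_le_of_sq_le_sq' h1 (mul_pos hu2 hv2).le
  linarith [this.2]

theorem cosh_hyperbolicDist {κ : ℝ} (hκ : κ < 0) (u v : Hyperboloid) :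
    Real.cosh (√(-κ) * hyperbolicDist κ u v) = -lorentzForm u.1 v.1 := by
  rw [hyperbolicDist, mul_div_cancel₀ _ (Real.sqrt_pos.2 (neg_pos.2 hκ)).ne',
    Real.cosh_arcosh (one_le_neg_lorentzForm u v)]

theorem hyperbolicDist_eq {κ : ℝ} (hκ : κ < 0) {u v : Hyperboloid} {t : ℝ}
    (h0 : 0 ≤ √(-κ) * t) (h : -lorentzForm u.1 v.1 = Real.cosh (√(-κ) * t)) :
    hyperbolicDist κ u v = t := by
  rw [hyperbolicDist, h, Real.arcosh_cosh h0,
    mul_div_cancel_left₀ _ (Real.sqrt_pos.2 (neg_pos.2 hκ)).ne']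

/-- Hyperbolic interpolation between two points. -/
theorem exists_hyperboloid_interpolation (x y : Hyperboloid) {a b : ℝ} (ha0 : 0 ≤ a)
    (hb0 : 0 ≤ b) (hab : 0 < a + b) (hxy : -lorentzForm x.1 y.1 = Real.cosh (a + b)) :
    ∃ p : Hyperboloid, -lorentzForm x.1 p.1 = Real.cosh b ∧ -lorentzForm p.1 y.1 = Real.cosh a ∧
      ∀ z : Fin 3 → ℝ, Real.sinh (a + b) * lorentzForm p.1 z =
        Real.sinh a * lorentzForm x.1 z + Real.sinh b * lorentzForm y.1 z := by
  have hs : 0 < Real.sinh (a + b) := Real.sinh_pos_iff.2 hab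
  have ha := Real.cosh_sq a
  have hb := Real.cosh_sq b
  have hx := x.2.1
  have hy := y.2.1
  set q : Fin 3 → ℝ := fun i => (Real.sinh (a + b))⁻¹ * (Real.sinh a * x.1 i + Real.sinh b * y.1 i)
    with hq
  have hqz : ∀ z : Fin 3 → ℝ, Real.sinh (a + b) * lorentzForm q z =
      Real.sinh a * lorentzForm x.1 z + Real.sinh b * lorentzForm y.1 z := by
    intro z
    simp only [hq, lorentzForm]
    field_simp
    ring
  have hqx : -lorentzForm x.1 q = Real.cosh b := by
    apply mul_left_cancel₀ hs.ne'
    rw [lorentzForm_comm, mul_neg, hqz, hx, lorentzForm_comm y.1, ← neg_neg (lorentzForm x.1 y.1),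
      hxy, Real.sinh_add, Real.cosh_add]
    linear_combination (-Real.sinh a) * hb
  have hqy : -lorentzForm q y.1 = Real.cosh a := by
    apply mul_left_cancel₀ hs.ne'
    rw [mul_neg, hqz, hy, ← neg_neg (lorentzForm x.1 y.1), hxy, Real.sinh_add, Real.cosh_add]
    linear_combination (-Real.sinh b) * ha
  have hqq : lorentzForm q q = -1 := by
    apply mul_left_cancel₀ hs.ne'
    rw [hqz, ← neg_neg (lorentzForm x.1 q), hqx, lorentzForm_comm, ← neg_neg (lorentzForm q y.1),
      hqy, Real.sinh_add]
    ring
  have h2 : 0 < q 2 := by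
    have hsa := Real.sinh_nonneg_iff.2 ha0
    have hsb := Real.sinh_nonneg_iff.2 hb0
    have hx2 := x.2.2
    have hy2 := y.2.2
    refine mul_pos (inv_pos.2 hs) ?_
    rcases ha0.eq_or_lt with rfl | ha0
    · have := Real.sinh_pos_iff.2 (by simpa using hab : 0 < b)
      have := mul_pos this hy2
      simpa using this
    · have h1 := mul_pos (Real.sinh_pos_iff.2 ha0) hx2
      have h2 := mul_nonneg hsb hy2.le
      linarith
  exact ⟨⟨q, hqq, h2⟩, hqx, hqy, hqz⟩

/-! ### Comparison inequalities in `CAT(κ)` spaces -/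

namespace IsCAT

variable {X : Type*} [MetricSpace X] {κ : ℝ}

theorem exists_geodesic_of_nonpos (hX : IsCAT κ X) (hκ : κ ≤ 0) (x y : X) :
    ∃ γ : ℝ → X, IsGeodesicPath γ x y :=
  hX.geodesic x y fun h => absurd h hκ.not_gt

/-- Stewart's inequality in `CAT(0)` spaces. -/
theorem stewart_euclidean (hX : IsCAT 0 X) {x y z : X} {γ : ℝ → X} (hγ : IsGeodesicPath γ x y)
    {s : ℝ} (hs : s ∈ Set.Icc 0 (dist x y)) :
    dist x y * dist (γ s) z ^ 2 ≤ (dist x y - s) * dist x z ^ 2 + s * dist y z ^ 2 -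
      s * (dist x y - s) * dist x y := by
  rcases (dist_nonneg (x := x) (y := y)).eq_or_lt with hd | hd
  · have h0 : s = 0 := le_antisymm (hd ▸ hs.2) hs.1
    simp [← hd, h0]
  obtain ⟨σ, hσ⟩ := hX.exists_geodesic_of_nonpos le_rfl x z
  obtain ⟨x', y', z', hxy, hyz, hxz, H⟩ := (hX.euclidean rfl x y z).vertex (by simp) hγ hσ
  set d := dist x y
  have h1 : dist x' (AffineMap.lineMap x' y' (s / d)) = s := by
    rw [dist_left_lineMap, hxy, Real.norm_of_nonneg (div_nonneg hs.1 hd.le),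
      div_mul_cancel₀ _ hd.ne']
  have h2 : dist (AffineMap.lineMap x' y' (s / d)) y' = d - s := by
    rw [dist_lineMap_right, hxy, Real.norm_of_nonneg (sub_nonneg.2 ((div_le_one hd).2 hs.2)),
      sub_mul, div_mul_cancel₀ _ hd.ne', one_mul]
  have h3 := H s hs _ h1 h2
  -- Stewart's theorem in the plane; the law of cosines `e3` eliminates the inner product.
  have h4 : d * dist (AffineMap.lineMap x' y' (s / d)) z' ^ 2 =
      (d - s) * dist x z ^ 2 + s * dist y z ^ 2 - s * (d - s) * d := by
    have e1 : AffineMap.lineMap x' y' (s / d) - z' =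
        (1 - s / d) • (x' - z') + (s / d) • (y' - z') := by
      rw [AffineMap.lineMap_apply_module]; module
    have e2 : x' - y' = (x' - z') - (y' - z') := by abel
    have e3 : d ^ 2 = ‖x' - z'‖ ^ 2 - 2 * inner ℝ (x' - z') (y' - z') + ‖y' - z'‖ ^ 2 := by
      rw [← hxy, dist_eq_norm, e2, norm_sub_sq_real]
    rw [← hyz, ← hxz, dist_eq_norm, dist_eq_norm, dist_eq_norm, e1, norm_add_sq_real, norm_smul,
      norm_smul, mul_pow, mul_pow, Real.norm_eq_abs, Real.norm_eq_abs, sq_abs, sq_abs,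
      real_inner_smul_left, real_inner_smul_right]
    field_simp
    linear_combination (s * (d - s)) * e3
  rw [← h4]
  gcongr

/-- Pairing the interpolated point with the third vertex gives equality in the model, and `cosh` is
increasing on nonnegative reals. -/
theorem stewart_hyperbolic (hX : IsCAT κ X) (hκ : κ < 0) {x y z : X} {γ : ℝ → X}
    (hγ : IsGeodesicPath γ x y) {s : ℝ} (hs : s ∈ Set.Icc 0 (dist x y)) :
    Real.sinh (√(-κ) * dist x y) * Real.cosh (√(-κ) * dist (γ s) z) ≤
      Real.sinh (√(-κ) * (dist x y - s)) * Real.cosh (√(-κ) * dist x z) +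
        Real.sinh (√(-κ) * s) * Real.cosh (√(-κ) * dist y z) := by
  rcases (dist_nonneg (x := x) (y := y)).eq_or_lt with hd | hd
  · have h0 : s = 0 := le_antisymm (hd ▸ hs.2) hs.1
    simp [← hd, h0]
  have hk : 0 < √(-κ) := Real.sqrt_pos.2 (neg_pos.2 hκ)
  obtain ⟨σ, hσ⟩ := hX.exists_geodesic_of_nonpos hκ.le x z
  have hself : ∀ u, hyperbolicDist κ u u = 0 := fun u =>
    hyperbolicDist_eq hκ (by simp) (by simp [u.2.1])
  obtain ⟨x', y', z', hxy, hyz, hxz, H⟩ := (hX.hyperbolic hκ x y z).vertex hself hγ hσ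
  have hs' : 0 ≤ dist x y - s := sub_nonneg.2 hs.2
  have hadd : √(-κ) * (dist x y - s) + √(-κ) * s = √(-κ) * dist x y := by ring
  have ha : 0 ≤ √(-κ) * (dist x y - s) := mul_nonneg hk.le hs'
  have hb : 0 ≤ √(-κ) * s := mul_nonneg hk.le hs.1
  obtain ⟨p, hp1, hp2, hp⟩ := exists_hyperboloid_interpolation x' y' ha hb
    (by rw [hadd]; positivity) (by rw [hadd, ← hxy, cosh_hyperbolicDist hκ])
  have h3 := H s hs p (hyperbolicDist_eq hκ hb hp1) (hyperbolicDist_eq hκ ha hp2)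
  have h4 : Real.cosh (√(-κ) * dist (γ s) z) ≤ -lorentzForm p.1 z'.1 := by
    rw [← cosh_hyperbolicDist hκ, Real.cosh_le_cosh, abs_of_nonneg (by positivity)]
    exact (mul_le_mul_of_nonneg_left h3 hk.le).trans (le_abs_self _)
  have h5 := hp z'.1
  rw [hadd] at h5
  calc _ ≤ Real.sinh (√(-κ) * dist x y) * -lorentzForm p.1 z'.1 :=
        mul_le_mul_of_nonneg_left h4 (Real.sinh_nonneg_iff.2 (by positivity))
    _ = _ := by
      rw [← hyz, ← hxz, cosh_hyperbolicDist hκ, cosh_hyperbolicDist hκ]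
      linear_combination -h5

/-- The inequality is reversed because `cos` decreases on `[0, π]`. The bound `hd` keeps perimeters
below `2π / √κ`, so that comparison applies. -/
theorem stewart_spherical (hX : IsCAT κ X) (hκ : 0 < κ)
    (hd : ∀ x y : X, √κ * dist x y < Real.pi / 2) {x y z : X} {γ : ℝ → X}
    (hγ : IsGeodesicPath γ x y) {s : ℝ} (hs : s ∈ Set.Icc 0 (dist x y)) :
    Real.sin (√κ * (dist x y - s)) * Real.cos (√κ * dist x z) +
        Real.sin (√κ * s) * Real.cos (√κ * dist y z) ≤
      Real.sin (√κ * dist x y) * Real.cos (√κ * dist (γ s) z) := by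
  rcases (dist_nonneg (x := x) (y := y)).eq_or_lt with hd0 | hd0
  · have h0 : s = 0 := le_antisymm (hd0 ▸ hs.2) hs.1
    simp [← hd0, h0]
  have hk : 0 < √κ := Real.sqrt_pos.2 hκ
  have hpi := Real.pi_pos
  have hd' : ∀ x y : X, dist x y < Real.pi / √κ / 2 := fun x y => by
    rw [div_right_comm, lt_div_iff₀' hk]; exact hd x y
  have hpk : 0 < Real.pi / √κ := by positivity
  obtain ⟨σ, hσ⟩ := hX.geodesic x z fun _ => by linarith [hd' x z]
  have hself : ∀ u, sphericalDist κ u u = 0 := fun u =>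
    sphericalDist_eq hκ (by simp) (by simp [hpi.le]) (by
      rw [real_inner_self_eq_norm_sq, norm_sphere]; simp)
  obtain ⟨x', y', z', hxy, hyz, hxz, H⟩ := (hX.spherical hκ x y z (by
    linarith [hd' x y, hd' y z, hd' x z])).vertex hself hγ hσ
  have hs' : 0 ≤ dist x y - s := sub_nonneg.2 hs.2
  have hadd : √κ * (dist x y - s) + √κ * s = √κ * dist x y := by ring
  have ha : 0 ≤ √κ * (dist x y - s) := mul_nonneg hk.le hs'
  have hb : 0 ≤ √κ * s := mul_nonneg hk.le hs.1
  have hsin : 0 < Real.sin (√κ * dist x y) :=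
    Real.sin_pos_of_pos_of_lt_pi (by positivity) (by linarith [hd x y])
  obtain ⟨p, hp1, hp2, hp⟩ := exists_sphere_interpolation x' y'
    (a := √κ * (dist x y - s)) (b := √κ * s) (by rwa [hadd])
    (by rw [hadd, ← hxy, cos_sphericalDist hκ])
  have h3 := H s hs p (sphericalDist_eq hκ hb (by linarith [hd x y]) hp1)
    (sphericalDist_eq hκ ha (by linarith [hd x y]) hp2)
  have h4 : inner ℝ (p : EuclideanSpace ℝ (Fin 3)) (z' : EuclideanSpace ℝ (Fin 3)) ≤
      Real.cos (√κ * dist (γ s) z) := by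
    rw [← cos_sphericalDist hκ]
    refine Real.cos_le_cos_of_nonneg_of_le_pi (by positivity) ?_
      (mul_le_mul_of_nonneg_left h3 hk.le)
    rw [mul_sphericalDist hκ]
    exact InnerProductGeometry.angle_le_pi _ _
  have h5 := hp z'
  rw [hadd] at h5
  calc _ = Real.sin (√κ * dist x y) *
        inner ℝ (p : EuclideanSpace ℝ (Fin 3)) (z' : EuclideanSpace ℝ (Fin 3)) := by
        rw [h5, ← hyz, ← hxz, cos_sphericalDist hκ, cos_sphericalDist hκ]
    _ ≤ _ := mul_le_mul_of_nonneg_left h4 hsin.le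

end IsCAT

/-! ### Convexity gauges and their existence in each curvature -/

/-- A function of the distance whose values along geodesics control squared distances, both from
the midpoint of two points and from the metric projection onto a convex set. -/
structure IsConvexityGauge (X : Type*) [MetricSpace X] (h : ℝ → ℝ) (A : ℝ) : Prop where
  pos : 0 < A
  continuous : Continuous h
  strictMonoOn : StrictMonoOn h (Set.range fun p : X × X => dist p.1 p.2)
  midpoint : ∀ {x y : X} {γ : ℝ → X}, IsGeodesicPath γ x y → ∀ z,
    dist x y ^ 2 ≤ A * (h (dist x z) + h (dist y z) - 2 * h (dist (γ (dist x y / 2)) z))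
  pythagoras : ∀ {c z w : X} {γ : ℝ → X}, IsGeodesicPath γ c z →
    (∀ s ∈ Set.Icc 0 (dist c z), dist c w ≤ dist (γ s) w) →
    dist c w ^ 2 ≤ A * (h (dist z w) - h (dist c z))

theorem one_add_sq_div_two_le_cosh {x : ℝ} (hx : 0 ≤ x) : 1 + x ^ 2 / 2 ≤ Real.cosh x := by
  have h1 : x / 2 ≤ Real.sinh (x / 2) := Real.self_le_sinh_iff.2 (by linarith)
  have h2 := pow_le_pow_left₀ (by linarith) h1 2
  have h3 : Real.cosh x = 1 + 2 * Real.sinh (x / 2) ^ 2 := by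
    rw [← mul_div_cancel₀ x two_ne_zero, mul_div_assoc, Real.cosh_two_mul, Real.cosh_sq]
    ring_nf
  rw [h3]
  linarith

theorem half_mem_Icc {d : ℝ} (hd : 0 ≤ d) : d / 2 ∈ Set.Icc 0 d :=
  ⟨by linarith, by linarith⟩

namespace IsCAT

variable {X : Type*} [MetricSpace X] {κ : ℝ}

theorem isConvexityGauge_euclidean (hX : IsCAT 0 X) :
    IsConvexityGauge X (fun t => t ^ 2) 2 where
  pos := two_pos
  continuous := by fun_prop
  strictMonoOn := by
    rintro _ ⟨p, rfl⟩ _ - h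
    exact pow_lt_pow_left₀ h dist_nonneg two_ne_zero
  midpoint := by
    intro x y γ hγ z
    have h := hX.stewart_euclidean hγ (z := z) (half_mem_Icc dist_nonneg)
    rcases (dist_nonneg (x := x) (y := y)).eq_or_lt with hd | hd
    · have : x = y := dist_eq_zero.1 hd.symm
      subst this
      have := hγ.1
      simp [this]
      linarith
    · refine le_of_mul_le_mul_left ?_ hd
      linarith
  pythagoras := by
    intro c z w γ hγ hc
    have key : dist c w ^ 2 + dist c z ^ 2 ≤ dist z w ^ 2 := by
      rcases (dist_nonneg (x := c) (y := z)).eq_or_lt with hd | hd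
      · have : c = z := dist_eq_zero.1 hd.symm
        subst this
        simp
      -- Minimality of `c` replaces `dist (γ s) w` by `dist c w` in Stewart's inequality; a factor
      -- `s` then cancels, and `s → 0` finishes.
      have hs : ∀ s ∈ Set.Ioc 0 (dist c z),
          dist c w ^ 2 + (dist c z - s) * dist c z ≤ dist z w ^ 2 := by
        intro s hs
        have h := hX.stewart_euclidean hγ (z := w) (Set.Ioc_subset_Icc_self hs)
        have h2 := pow_le_pow_left₀ dist_nonneg (hc s (Set.Ioc_subset_Icc_self hs)) 2
        have h3 := mul_le_mul_of_nonneg_left h2 hd.le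
        refine le_of_mul_le_mul_left ?_ hs.1
        linarith
      refine le_of_tendsto (f := fun s => dist c w ^ 2 + (dist c z - s) * dist c z)
        (x := 𝓝[>] 0) ?_ (eventually_of_mem (Ioc_mem_nhdsGT hd) hs)
      refine tendsto_nhdsWithin_of_tendsto_nhds ?_
      refine Continuous.tendsto' (by fun_prop) _ _ ?_
      ring
    linarith [sq_nonneg (dist c w)]

/-- The constant comes from the midpoint: with `a` half the scaled side, the bracket is at least `2
(cosh a - 1) ≥ a² = -κ d² / 4`. -/
theorem isConvexityGauge_hyperbolic (hX : IsCAT κ X) (hκ : κ < 0) :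
    IsConvexityGauge X (fun t => Real.cosh (√(-κ) * t)) (4 / -κ) := by
  have hk : 0 < √(-κ) := Real.sqrt_pos.2 (neg_pos.2 hκ)
  have hk2 : √(-κ) ^ 2 = -κ := Real.sq_sqrt (neg_pos.2 hκ).le
  have hκ' := neg_pos.2 hκ
  refine ⟨by positivity, by fun_prop, ?_, ?_, ?_⟩
  · rintro _ ⟨p, rfl⟩ _ ⟨q, rfl⟩ h
    rw [Real.cosh_lt_cosh, abs_of_nonneg (by positivity), abs_of_nonneg (by positivity)]
    exact mul_lt_mul_of_pos_left h hk
  · intro x y γ hγ z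
    have h := hX.stewart_hyperbolic hκ hγ (z := z) (half_mem_Icc dist_nonneg)
    rcases (dist_nonneg (x := x) (y := y)).eq_or_lt with hd | hd
    · have : x = y := dist_eq_zero.1 hd.symm
      subst this
      have := hγ.1
      simp [this]
      rw [← two_mul, sub_self, mul_zero]
    set a := √(-κ) * (dist x y / 2) with ha
    have e1 : √(-κ) * dist x y = 2 * a := by rw [ha]; ring
    have e2 : √(-κ) * (dist x y - dist x y / 2) = a := by rw [ha]; ring
    have hapos : 0 < a := by positivity
    rw [e1, e2, Real.sinh_two_mul, ← mul_add, mul_right_comm, mul_comm 2, mul_assoc, mul_assoc]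
      at h
    have h1 := le_of_mul_le_mul_left h (Real.sinh_pos_iff.2 hapos)
    have h2 := Real.one_le_cosh (√(-κ) * dist (γ (dist x y / 2)) z)
    have h3 := one_add_sq_div_two_le_cosh hapos.le
    have h4 : a ^ 2 = -κ * dist x y ^ 2 / 4 := by rw [ha, mul_pow, hk2]; ring
    rw [div_mul_eq_mul_div, le_div_iff₀ hκ']
    nlinarith
  · intro c z w γ hγ hc
    have key : Real.cosh (√(-κ) * dist c z) * Real.cosh (√(-κ) * dist c w) ≤
        Real.cosh (√(-κ) * dist z w) := by
      rcases (dist_nonneg (x := c) (y := z)).eq_or_lt with hd | hd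
      · have : c = z := dist_eq_zero.1 hd.symm
        subst this
        simp
      -- Half-steps turn `sinh d - sinh (d - s)` and `sinh s` into products with the common factor
      -- `2 sinh (s / 2)` (arguments scaled by `√(-κ)`), which cancels before `s → 0`.
      have hs : ∀ s ∈ Set.Ioc 0 (dist c z),
          Real.cosh (√(-κ) * (dist c z - s / 2)) * Real.cosh (√(-κ) * dist c w) ≤
            Real.cosh (√(-κ) * (s / 2)) * Real.cosh (√(-κ) * dist z w) := by
        intro s hs
        have h := hX.stewart_hyperbolic hκ hγ (z := w) (Set.Ioc_subset_Icc_self hs)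
        have h2 : Real.cosh (√(-κ) * dist c w) ≤ Real.cosh (√(-κ) * dist (γ s) w) := by
          rw [Real.cosh_le_cosh, abs_of_nonneg (by positivity), abs_of_nonneg (by positivity)]
          exact mul_le_mul_of_nonneg_left (hc s (Set.Ioc_subset_Icc_self hs)) hk.le
        have h3 := mul_le_mul_of_nonneg_left h2
          (Real.sinh_nonneg_iff.2 (by positivity : 0 ≤ √(-κ) * dist c z))
        have hspos : 0 < √(-κ) * (s / 2) := mul_pos hk (half_pos hs.1)
        refine le_of_mul_le_mul_left ?_ (Real.sinh_pos_iff.2 hspos)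
        have e1 : √(-κ) * dist c z = √(-κ) * (dist c z - s / 2) + √(-κ) * (s / 2) := by ring
        have e2 : √(-κ) * (dist c z - s) = √(-κ) * (dist c z - s / 2) - √(-κ) * (s / 2) := by ring
        have e3 : √(-κ) * s = 2 * (√(-κ) * (s / 2)) := by ring
        have h4 := h3.trans h
        rw [e2, e3, e1, Real.sinh_sub, Real.sinh_add, Real.sinh_two_mul] at h4
        linarith
      refine le_of_tendsto_of_tendsto
        (f := fun s => Real.cosh (√(-κ) * (dist c z - s / 2)) * Real.cosh (√(-κ) * dist c w))
        (g := fun s => Real.cosh (√(-κ) * (s / 2)) * Real.cosh (√(-κ) * dist z w))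
        (b := 𝓝[>] 0) ?_ ?_ (eventually_of_mem (Ioc_mem_nhdsGT hd) hs)
      · exact tendsto_nhdsWithin_of_tendsto_nhds (Continuous.tendsto' (by fun_prop) _ _ (by simp))
      · exact tendsto_nhdsWithin_of_tendsto_nhds (Continuous.tendsto' (by fun_prop) _ _ (by simp))
    have h2 := Real.one_le_cosh (√(-κ) * dist c z)
    have h3 := one_add_sq_div_two_le_cosh (by positivity : 0 ≤ √(-κ) * dist c w)
    have h4 : (√(-κ) * dist c w) ^ 2 = -κ * dist c w ^ 2 := by rw [mul_pow, hk2]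
    rw [div_mul_eq_mul_div, le_div_iff₀ hκ']
    nlinarith [mul_nonneg hκ'.le (sq_nonneg (dist c w))]

/-- Cosines of scaled distances are at least `cos (√κ D) > 0`, and `1 - cos a ≥ 2a² / π²` on `[0,
π]`; at the midpoint, where `a² = κ d² / 4`, these produce the constant. -/
theorem isConvexityGauge_spherical (hX : IsCAT κ X) (hκ : 0 < κ) {D : ℝ} (hD0 : 0 ≤ D)
    (hD : √κ * D < Real.pi / 2) (hdist : ∀ x y : X, dist x y ≤ D) :
    IsConvexityGauge X (fun t => -Real.cos (√κ * t))
      (Real.pi ^ 2 / (κ * Real.cos (√κ * D))) := by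
  have hk : 0 < √κ := Real.sqrt_pos.2 hκ
  have hk2 : √κ ^ 2 = κ := Real.sq_sqrt hκ.le
  have hpi := Real.pi_pos
  have hle : ∀ x y : X, √κ * dist x y ≤ √κ * D := fun x y =>
    mul_le_mul_of_nonneg_left (hdist x y) hk.le
  have hd : ∀ x y : X, √κ * dist x y < Real.pi / 2 := fun x y => (hle x y).trans_lt hD
  have hcD : 0 < Real.cos (√κ * D) :=
    Real.cos_pos_of_mem_Ioo ⟨by linarith [mul_nonneg hk.le hD0], hD⟩
  have hcos : ∀ x y : X, Real.cos (√κ * D) ≤ Real.cos (√κ * dist x y) := fun x y =>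
    Real.cos_le_cos_of_nonneg_of_le_pi (by positivity) (by linarith) (hle x y)
  have hquad : ∀ t, 0 ≤ t → t ≤ Real.pi → 2 * t ^ 2 ≤ Real.pi ^ 2 * (1 - Real.cos t) := by
    intro t h0 ht
    have h := Real.cos_le_one_sub_mul_cos_sq (x := t) (by rwa [abs_of_nonneg h0])
    have h2 : Real.pi ^ 2 * (2 / Real.pi ^ 2 * t ^ 2) = 2 * t ^ 2 := by field_simp
    nlinarith [mul_le_mul_of_nonneg_left h (sq_nonneg Real.pi)]
  refine ⟨by positivity, by fun_prop, ?_, ?_, ?_⟩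
  · rintro _ ⟨p, rfl⟩ _ ⟨q, rfl⟩ h
    refine neg_lt_neg (Real.cos_lt_cos_of_nonneg_of_le_pi (by positivity) ?_
      (mul_lt_mul_of_pos_left h hk))
    linarith [hd q.1 q.2]
  · intro x y γ hγ z
    have h := hX.stewart_spherical hκ hd hγ (z := z) (half_mem_Icc dist_nonneg)
    rcases (dist_nonneg (x := x) (y := y)).eq_or_lt with hd0 | hd0
    · have : x = y := dist_eq_zero.1 hd0.symm
      subst this
      have := hγ.1
      simp [this]
      refine (mul_eq_zero_of_right _ ?_).ge
      ring
    set a := √κ * (dist x y / 2) with ha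
    have e1 : √κ * dist x y = 2 * a := by rw [ha]; ring
    have e2 : √κ * (dist x y - dist x y / 2) = a := by rw [ha]; ring
    have hapos : 0 < a := by positivity
    have hapi : a ≤ Real.pi := by linarith [hd x y]
    rw [e1, e2, Real.sin_two_mul, ← mul_add, mul_right_comm, mul_comm 2, mul_assoc, mul_assoc]
      at h
    have h1 := le_of_mul_le_mul_left h (Real.sin_pos_of_pos_of_lt_pi hapos (by linarith [hd x y]))
    have h2 := hcos (γ (dist x y / 2)) z
    have h3 := hquad a hapos.le hapi
    have h4 : a ^ 2 = κ * dist x y ^ 2 / 4 := by rw [ha, mul_pow, hk2]; ring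
    have h5 := mul_le_mul_of_nonneg_right h2 (sub_nonneg.2 (Real.cos_le_one a))
    have h6 := mul_le_mul_of_nonneg_left h5 (sq_nonneg Real.pi)
    have h7 := mul_le_mul_of_nonneg_left h3 hcD.le
    have h8 := mul_le_mul_of_nonneg_left h1 (sq_nonneg Real.pi)
    rw [div_mul_eq_mul_div, le_div_iff₀ (by positivity)]
    rw [h4] at h7
    linarith
  · intro c z w γ hγ hc
    have key : Real.cos (√κ * dist z w) ≤
        Real.cos (√κ * dist c z) * Real.cos (√κ * dist c w) := by
      rcases (dist_nonneg (x := c) (y := z)).eq_or_lt with hd0 | hd0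
      · have : c = z := dist_eq_zero.1 hd0.symm
        subst this
        simp
      have hs : ∀ s ∈ Set.Ioc 0 (dist c z),
          Real.cos (√κ * (s / 2)) * Real.cos (√κ * dist z w) ≤
          Real.cos (√κ * (dist c z - s / 2)) * Real.cos (√κ * dist c w) := by
        intro s hs
        have h := hX.stewart_spherical hκ hd hγ (z := w) (Set.Ioc_subset_Icc_self hs)
        have h2 : Real.cos (√κ * dist (γ s) w) ≤ Real.cos (√κ * dist c w) :=
          Real.cos_le_cos_of_nonneg_of_le_pi (by positivity) (by linarith [hd (γ s) w])
            (mul_le_mul_of_nonneg_left (hc s (Set.Ioc_subset_Icc_self hs)) hk.le)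
        have h3 := mul_le_mul_of_nonneg_left h2 (Real.sin_nonneg_of_nonneg_of_le_pi
          (by positivity : 0 ≤ √κ * dist c z) (by linarith [hd c z]))
        have hspos : 0 < √κ * (s / 2) := mul_pos hk (half_pos hs.1)
        have hspi : √κ * (s / 2) < Real.pi := by
          have := mul_le_mul_of_nonneg_left hs.2 hk.le
          linarith [hd c z]
        refine le_of_mul_le_mul_left ?_ (Real.sin_pos_of_pos_of_lt_pi hspos hspi)
        have e1 : √κ * dist c z = √κ * (dist c z - s / 2) + √κ * (s / 2) := by ring
        have e2 : √κ * (dist c z - s) = √κ * (dist c z - s / 2) - √κ * (s / 2) := by ring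
        have e3 : √κ * s = 2 * (√κ * (s / 2)) := by ring
        have h4 := h.trans h3
        rw [e2, e3, e1, Real.sin_sub, Real.sin_add, Real.sin_two_mul] at h4
        linarith
      refine le_of_tendsto_of_tendsto
        (f := fun s => Real.cos (√κ * (s / 2)) * Real.cos (√κ * dist z w))
        (g := fun s => Real.cos (√κ * (dist c z - s / 2)) * Real.cos (√κ * dist c w))
        (b := 𝓝[>] 0) ?_ ?_ (eventually_of_mem (Ioc_mem_nhdsGT hd0) hs)
      · exact tendsto_nhdsWithin_of_tendsto_nhds (Continuous.tendsto' (by fun_prop) _ _ (by simp))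
      · exact tendsto_nhdsWithin_of_tendsto_nhds (Continuous.tendsto' (by fun_prop) _ _ (by simp))
    have h2 := hcos c z
    have h3 := hquad (√κ * dist c w) (by positivity) (by linarith [hd c w])
    have h4 : (√κ * dist c w) ^ 2 = κ * dist c w ^ 2 := by rw [mul_pow, hk2]
    have h5 := mul_le_mul_of_nonneg_right h2
      (sub_nonneg.2 (Real.cos_le_one (√κ * dist c w)))
    have h6 := mul_le_mul_of_nonneg_left h5 (sq_nonneg Real.pi)
    have h7 := mul_le_mul_of_nonneg_left h3 hcD.le
    have h8 := mul_le_mul_of_nonneg_left key (sq_nonneg Real.pi)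
    have h9 : 0 ≤ Real.cos (√κ * D) * (κ * dist c w ^ 2) := by positivity
    rw [div_mul_eq_mul_div, le_div_iff₀ (by positivity)]
    rw [h4] at h7
    linarith

theorem exists_isConvexityGauge (hX : IsCAT κ X)
    (hdiam : 0 < κ → Metric.ediam (Set.univ : Set X) < ENNReal.ofReal (Real.pi / (2 * √κ))) :
    (∀ x y : X, ∃ γ : ℝ → X, IsGeodesicPath γ x y) ∧ ∃ h A, IsConvexityGauge X h A := by
  rcases lt_trichotomy κ 0 with hκ | rfl | hκ
  · exact ⟨hX.exists_geodesic_of_nonpos hκ.le, _, _, hX.isConvexityGauge_hyperbolic hκ⟩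
  · exact ⟨hX.exists_geodesic_of_nonpos le_rfl, _, _, hX.isConvexityGauge_euclidean⟩
  · have hk : 0 < √κ := Real.sqrt_pos.2 hκ
    have hpi := Real.pi_pos
    set D := (Metric.ediam (Set.univ : Set X)).toReal with hDdef
    have hdist : ∀ x y : X, dist x y ≤ D := fun x y => by
      rw [dist_edist]
      exact ENNReal.toReal_mono (hdiam hκ).ne_top
        (Metric.edist_le_ediam_of_mem (Set.mem_univ x) (Set.mem_univ y))
    have hD : D < Real.pi / (2 * √κ) := by
      rw [hDdef]
      exact (ENNReal.lt_ofReal_iff_toReal_lt (hdiam hκ).ne_top).1 (hdiam hκ)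
    have hD' : √κ * D < Real.pi / 2 := by
      rw [lt_div_iff₀ (by positivity)] at hD
      linarith
    refine ⟨fun x y => hX.geodesic x y fun _ => ?_, _, _,
      hX.isConvexityGauge_spherical hκ ENNReal.toReal_nonneg hD' hdist⟩
    refine (hdist x y).trans_lt ?_
    rw [lt_div_iff₀' hk]
    linarith

end IsCAT

/-! ### Metric projections in the presence of a gauge -/

namespace IsConvexityGauge

variable {X : Type*} [MetricSpace X] {h : ℝ → ℝ} {A : ℝ} {C : Set X}

theorem le_iff_le (hg : IsConvexityGauge X h A) {x y z w : X} :
    h (dist x y) ≤ h (dist z w) ↔ dist x y ≤ dist z w :=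
  hg.strictMonoOn.le_iff_le ⟨(x, y), rfl⟩ ⟨(z, w), rfl⟩

/-- Pythagorean inequality for the metric projection onto a convex set. -/
theorem sq_dist_projection_le (hg : IsConvexityGauge X h A)
    (hgeo : ∀ x y : X, ∃ γ : ℝ → X, IsGeodesicPath γ x y) (hC : GeodesicConvex C) {w c z : X}
    (hc : c ∈ metricProjection C w) (hz : z ∈ C) :
    dist w c ^ 2 ≤ A * (h (dist w z) - h (dist c z)) := by
  obtain ⟨γ, hγ⟩ := hgeo c z
  rw [dist_comm w c, dist_comm w z]
  refine hg.pythagoras hγ fun s hs => ?_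
  rw [dist_comm c, dist_comm _ w, hc.2]
  exact Metric.infDist_le_dist_of_mem (hC c hc.1 z hz γ hγ s hs)

/-- The right side of the Pythagorean inequality is nonnegative, and `h` is strictly increasing on
distances. -/
theorem dist_projection_le (hg : IsConvexityGauge X h A)
    (hgeo : ∀ x y : X, ∃ γ : ℝ → X, IsGeodesicPath γ x y) (hC : GeodesicConvex C) {w c z : X}
    (hc : c ∈ metricProjection C w) (hz : z ∈ C) : dist c z ≤ dist w z :=
  hg.le_iff_le.1 <| sub_nonneg.1 <| nonneg_of_mul_nonneg_right
    ((sq_nonneg _).trans (hg.sq_dist_projection_le hgeo hC hc hz)) hg.pos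

/-- If projecting does not change the distance to a common point in the limit, then it does not
move points in the limit. -/
theorem tendsto_dist_projection (hg : IsConvexityGauge X h A)
    (hgeo : ∀ x y : X, ∃ γ : ℝ → X, IsGeodesicPath γ x y) {C : ℕ → Set X}
    (hC : ∀ n, GeodesicConvex (C n)) {w c : ℕ → X} {z : X}
    (hc : ∀ n, c n ∈ metricProjection (C n) (w n)) (hz : ∀ n, z ∈ C n) {L : ℝ}
    (hw : Tendsto (fun n => dist (w n) z) atTop (𝓝 L))
    (hcz : Tendsto (fun n => dist (c n) z) atTop (𝓝 L)) :
    Tendsto (fun n => dist (w n) (c n)) atTop (𝓝 0) := by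
  have hlim : Tendsto (fun n => A * (h (dist (w n) z) - h (dist (c n) z))) atTop (𝓝 0) := by
    have hL := hg.continuous.tendsto L
    simpa using ((hL.comp hw).sub (hL.comp hcz)).const_mul A
  have hsq : Tendsto (fun n => dist (w n) (c n) ^ 2) atTop (𝓝 0) :=
    squeeze_zero (fun _ => sq_nonneg _)
      (fun n => hg.sq_dist_projection_le hgeo (hC n) (hc n) (hz n)) hlim
  simpa [Real.sqrt_sq dist_nonneg] using hsq.sqrt

/-- Points of a convex set that nearly realize the distance to a given point are close together. -/
theorem sq_dist_le_of_mem (hg : IsConvexityGauge X h A)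
    (hgeo : ∀ x y : X, ∃ γ : ℝ → X, IsGeodesicPath γ x y) (hC : GeodesicConvex C) (x : X)
    {y z : X} (hy : y ∈ C) (hz : z ∈ C) :
    dist y z ^ 2 ≤ A * (h (dist x y) + h (dist x z) - 2 * h (Metric.infDist x C)) := by
  obtain ⟨γ, hγ⟩ := hgeo y z
  have hm : γ (dist y z / 2) ∈ C := hC y hy z hz γ hγ _ (half_mem_Icc dist_nonneg)
  have h1 := hg.midpoint hγ x
  rw [dist_comm y x, dist_comm z x] at h1
  refine h1.trans (mul_le_mul_of_nonneg_left ?_ hg.pos.le)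
  suffices h (Metric.infDist x C) ≤ h (dist (γ (dist y z / 2)) x) by linarith
  set m := γ (dist y z / 2)
  rw [dist_comm m x]
  rcases (Metric.infDist_le_dist_of_mem (x := x) hm).eq_or_lt with he | hlt
  · rw [he]
  -- Monotonicity of `h` is known only on attained distances, and the infimum may not be one. A
  -- point `u` of `C`, closer to `x` than `m` and nearly optimal, is used instead, with continuity
  -- of `h`.
  · refine le_of_forall_pos_le_add fun η hη => ?_
    have hev := (hg.continuous.tendsto (Metric.infDist x C)).eventually
      (lt_mem_nhds (sub_lt_self _ hη))
    obtain ⟨δ, hδ, hball⟩ := Metric.eventually_nhds_iff.1 hev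
    obtain ⟨u, hu, hxu⟩ := (Metric.infDist_lt_iff ⟨y, hy⟩).1
      (lt_min hlt (lt_add_of_pos_right (Metric.infDist x C) hδ))
    have h2 := hg.le_iff_le.2 (hxu.trans_le (min_le_left _ _)).le
    have h3 := hball (y := dist x u) (by
      rw [Real.dist_eq, abs_of_nonneg (sub_nonneg.2 (Metric.infDist_le_dist_of_mem hu))]
      linarith [hxu.trans_le (min_le_right _ _)])
    linarith

/-- By `sq_dist_le_of_mem` minimizing sequences are Cauchy and two minimizers coincide. -/
theorem existsUnique_mem_metricProjection [CompleteSpace X] (hg : IsConvexityGauge X h A)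
    (hgeo : ∀ x y : X, ∃ γ : ℝ → X, IsGeodesicPath γ x y) (hC : GeodesicConvex C)
    (hclosed : IsClosed C) (hne : C.Nonempty) (x : X) : ∃! c, c ∈ metricProjection C x := by
  have hex : ∀ n : ℕ, ∃ y ∈ C, dist x y < Metric.infDist x C + 1 / ((n : ℝ) + 1) := fun n =>
    (Metric.infDist_lt_iff hne).1 (lt_add_of_pos_right _ Nat.one_div_pos_of_nat)
  choose y hyC hy using hex
  have hlim : Tendsto (fun n => dist x (y n)) atTop (𝓝 (Metric.infDist x C)) := by
    refine tendsto_of_tendsto_of_tendsto_of_le_of_le tendsto_const_nhds ?_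
      (fun n => Metric.infDist_le_dist_of_mem (hyC n)) (fun n => (hy n).le)
    simpa using tendsto_one_div_add_atTop_nhds_zero_nat.const_add (Metric.infDist x C)
  have hcau : CauchySeq y := by
    have hh := (hg.continuous.tendsto _).comp hlim
    have h2 := (((hh.comp tendsto_fst).add (hh.comp tendsto_snd)).sub_const
      (2 * h (Metric.infDist x C))).const_mul A
    rw [← two_mul, sub_self, mul_zero, prod_atTop_atTop_eq] at h2
    have hsq : Tendsto (fun p : ℕ × ℕ => dist (y p.1) (y p.2) ^ 2) atTop (𝓝 0) :=
      squeeze_zero (fun _ => sq_nonneg _)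
        (fun p => hg.sq_dist_le_of_mem hgeo hC x (hyC p.1) (hyC p.2)) h2
    rw [cauchySeq_iff_tendsto_dist_atTop_0]
    simpa [Real.sqrt_sq dist_nonneg] using hsq.sqrt
  obtain ⟨c, hc⟩ := cauchySeq_tendsto_of_complete hcau
  have hcC := hclosed.mem_of_tendsto hc (Eventually.of_forall hyC)
  have hxc := tendsto_nhds_unique (tendsto_const_nhds.dist hc) hlim
  refine ⟨c, ⟨hcC, hxc⟩, fun c' hc' => ?_⟩
  have h1 := hg.sq_dist_le_of_mem hgeo hC x hc'.1 hcC
  rw [hc'.2, hxc, ← two_mul, sub_self, mul_zero] at h1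
  exact dist_eq_zero.1 ((sq_nonpos_iff _).1 h1)

end IsConvexityGauge

/-! ### Asymptotic regularity from monotone distances to a common point -/

/-- A nonnegative sequence which is decreasing up to summable errors converges. -/
theorem exists_tendsto_of_le_add_summable {u ε : ℕ → ℝ} (hu : ∀ n, 0 ≤ u n) (hε0 : ∀ n, 0 ≤ ε n)
    (hε : Summable ε) (hle : ∀ n, u (n + 1) ≤ u n + ε n) : ∃ L, Tendsto u atTop (𝓝 L) := by
  have hanti : Antitone fun n => u n - ∑ i ∈ Finset.range n, ε i :=
    antitone_nat_of_succ_le fun n => by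
      rw [Finset.sum_range_succ]
      linarith [hle n]
  have hbdd : BddBelow (Set.range fun n => u n - ∑ i ∈ Finset.range n, ε i) := by
    refine ⟨-∑' i, ε i, ?_⟩
    rintro _ ⟨n, rfl⟩
    have := hε.sum_le_tsum (Finset.range n) fun i _ => hε0 i
    simp only
    linarith [hu n]
  refine ⟨_, ((tendsto_atTop_ciInf hanti hbdd).add hε.hasSum.tendsto_sum_nat).congr fun n => ?_⟩
  ring

/-- Strong quasi-nonexpansiveness with respect to the point `z`. -/
structure StronglyQuasiNonexpansive {X : Type*} [MetricSpace X] (z : X) (T : X → X) : Prop where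
  dist_le : ∀ w, dist (T w) z ≤ dist w z
  tendsto : ∀ (w : ℕ → X) (L : ℝ), Tendsto (fun n => dist (w n) z) atTop (𝓝 L) →
    Tendsto (fun n => dist (T (w n)) z) atTop (𝓝 L) →
    Tendsto (fun n => dist (w n) (T (w n))) atTop (𝓝 0)

namespace StronglyQuasiNonexpansive

variable {X : Type*} [MetricSpace X] {z : X}

/-- The distance from `g w` to `z` lies between those of `f (g w)` and `w`, so all three share the
limit and each factor moves its argument negligibly. -/
theorem comp {f g : X → X} (hf : StronglyQuasiNonexpansive z f)
    (hg : StronglyQuasiNonexpansive z g) : StronglyQuasiNonexpansive z (f ∘ g) where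
  dist_le w := (hf.dist_le _).trans (hg.dist_le w)
  tendsto w L hw hfg := by
    have hgw : Tendsto (fun n => dist (g (w n)) z) atTop (𝓝 L) :=
      tendsto_of_tendsto_of_tendsto_of_le_of_le hfg hw (fun n => hf.dist_le _)
        (fun n => hg.dist_le _)
    refine squeeze_zero (fun _ => dist_nonneg) (fun n => dist_triangle _ (g (w n)) _) ?_
    simpa using (hg.tendsto w L hw hgw).add (hf.tendsto (fun n => g (w n)) L hgw hfg)

theorem foldr_comp {l : List (X → X)} (hl : ∀ f ∈ l, StronglyQuasiNonexpansive z f) :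
    StronglyQuasiNonexpansive z (l.foldr (fun f g => f ∘ g) id) := by
  induction l with
  | nil => exact ⟨fun _ => le_rfl, fun _ _ _ _ => by simp⟩
  | cons f l ih =>
    exact (hl f List.mem_cons_self).comp (ih fun g hg => hl g (List.mem_cons_of_mem _ hg))

theorem asymptoticallyRegularMap {T : X → X} (hT : StronglyQuasiNonexpansive z T) :
    AsymptoticallyRegularMap T := by
  intro x
  obtain ⟨L, hL⟩ := exists_tendsto_of_le_add_summable (u := fun n => dist (T^[n] x) z) (ε := 0)
    (fun _ => dist_nonneg) (fun _ => le_rfl) summable_zero fun n => by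
      simpa [Function.iterate_succ_apply'] using hT.dist_le (T^[n] x)
  have hL' := (tendsto_add_atTop_iff_nat 1).2 hL
  simp only [Function.iterate_succ_apply'] at hL'
  simpa only [AsymptoticallyRegularSeq, Function.iterate_succ_apply'] using
    hT.tendsto (fun n => T^[n] x) L hL hL'

end StronglyQuasiNonexpansive

theorem mainTheorem11 (κ : ℝ) {X : Type*} [MetricSpace X] (hX : IsCAT κ X)
    (hdiam : 0 < κ →
      Metric.ediam (Set.univ : Set X) < ENNReal.ofReal (Real.pi / (2 * √κ)))
    (r : ℕ) (hr : 0 < r) (C : Fin r → Set X)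
    (hclosed : ∀ i, IsClosed (C i)) (hconvex : ∀ i, GeodesicConvex (C i))
    (hinter : (⋂ i, C i).Nonempty) :
    (CompleteSpace X → ∀ i x, ∃! c, c ∈ metricProjection (C i) x) ∧
    ∀ P : Fin r → X → X, (∀ i x, P i x ∈ metricProjection (C i) x) →
      (∀ (ε : ℕ → ℝ) (x : ℕ → X), Summable ε →
        (∀ n, dist (x (n + 1)) (P ⟨n % r, Nat.mod_lt n hr⟩ (x n)) ≤ ε n) →
          AsymptoticallyRegularSeq x) ∧
      AsymptoticallyRegularMap (finComp P) := by
  obtain ⟨z, hz⟩ := hinter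
  rw [Set.mem_iInter] at hz
  obtain ⟨hgeo, h, A, hg⟩ := hX.exists_isConvexityGauge hdiam
  refine ⟨fun _ i x => hg.existsUnique_mem_metricProjection hgeo (hconvex i) (hclosed i)
    ⟨z, hz i⟩ x, fun P hP => ⟨fun ε x hε hx => ?_, ?_⟩⟩
  · set c : ℕ → X := fun n => P ⟨n % r, Nat.mod_lt n hr⟩ (x n)
    have hcx : ∀ n, dist (c n) z ≤ dist (x n) z := fun n =>
      hg.dist_projection_le hgeo (hconvex _) (hP _ _) (hz _)
    have hxc : ∀ n, dist (x (n + 1)) z ≤ ε n + dist (c n) z := fun n =>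
      (dist_triangle _ (c n) _).trans (add_le_add_left (hx n) _)
    obtain ⟨L, hL⟩ := exists_tendsto_of_le_add_summable (u := fun n => dist (x n) z)
      (fun _ => dist_nonneg) (fun n => dist_nonneg.trans (hx n)) hε
      fun n => by linarith [hcx n, hxc n]
    have hε0 := hε.tendsto_atTop_zero
    -- Squeezed by `d(x (n + 1), z) - ε n ≤ d(c n, z) ≤ d(x n, z)`.
    have hcL : Tendsto (fun n => dist (c n) z) atTop (𝓝 L) := by
      refine tendsto_of_tendsto_of_tendsto_of_le_of_le ?_ hL
        (fun n => sub_le_iff_le_add'.2 (hxc n)) hcx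
      simpa using ((tendsto_add_atTop_iff_nat 1).2 hL).sub hε0
    have hlim := hg.tendsto_dist_projection hgeo (C := fun n => C ⟨n % r, Nat.mod_lt n hr⟩)
      (fun _ => hconvex _) (fun n => hP _ (x n)) (fun _ => hz _) hL hcL
    refine squeeze_zero (fun _ => dist_nonneg)
      (fun n => (dist_triangle_right _ _ (c n)).trans (add_le_add_right (hx n) _)) ?_
    simpa using hlim.add hε0
  · refine StronglyQuasiNonexpansive.asymptoticallyRegularMap (z := z)
      (StronglyQuasiNonexpansive.foldr_comp fun f hf => ?_)
    obtain ⟨i, rfl⟩ := (List.mem_ofFn' _ _).1 hf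
    exact ⟨fun w => hg.dist_projection_le hgeo (hconvex i) (hP i w) (hz i), fun w L hw hT =>
      hg.tendsto_dist_projection hgeo (C := fun _ => C i) (fun _ => hconvex i)
        (fun n => hP i (w n)) (fun _ => hz i) hw hT⟩
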